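/- Let $(\Omega,d)$ be a metric space with a Borel probability measure $\mu$. For measurable $u:\Omega\to\mathbb R$ put $\lambda_u(t)=\mu\{|u|>t\}$, $u^*(s)=\inf\{t\ge 0:\lambda_u(t)\le s\}$ and $u^{**}(t)=\frac1t\int_0^t u^*(s)\,ds$ (with the analogous definitions for functions on $(0,1)$ with Lebesgue measure). For a Borel set $A$ let $\mathrm{Per}(A)=\liminf_{\varepsilon\to0^+}\frac{\mu(A_\varepsilon)-\mu(A)}{\varepsilon}$, where $A_\varepsilon=\{x:\exists y\in A,\ d(x,y)<\varepsilon\}$, and let the isoperimetric profile $I:[0,1]\to[0,\infty)$ be the pointwise largest function with $\mathrm{Per}(A)\ge I(\mu(A))$ for all Borel sets $A$ (it is assumed to exist). For $f:\Omega\to\mathbb R$ Lipschitz let $|\nabla f|(x)=\limsup_{d(x,y)\to0,\ y\ne x}\frac{|f(x)-f(y)|}{d(x,y)}$ (equal to $0$ at isolated points). Suppose that $I$ is concave and continuous on $[0,1]$, nondecreasing on $(0,1/2)$, and symmetric about $1/2$, i.e. $I(1-t)=I(t)$. Then the following four statements hold, and they are equivalent: (i) for all Lipschitz $f$, $\displaystyle\int_0^\infty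 I(\lambda_f(s))\,ds\le\int_\Omega|\nabla f|\,d\mu$; (ii) for all Lipschitz $f$, the functions $f^*$ and $s\mapsto\int_{\{|f|>f^*(s)\}}|\nabla f|\,d\mu$ are differentiable at almost every $s\in(0,1)$, and at every $s\in(0,1)$ where both are differentiable, $$(-f^*)'(s)\,I(s)\le\frac{d}{ds}\int_{\{|f|>f^*(s)\}}|\nabla f|\,d\mu;$$ (iii) for all Lipschitz $f$ and all $t\in(0,1]$, $\displaystyle\int_0^t\big((-f^*)'I\big)^*(s)\,ds\le\int_0^t|\nabla f|^*(s)\,ds$, where $(-f^*)'$ is the almost everywhere defined derivative and the outer rearrangement on the left is with respect to Lebesgue measure on $(0,1)$; (iv) for all Lipschitz $f$ and all $t\in(0,1]$ with $I(t)\ne0$, $\displaystyle f^{**}(t)-f^*(t)\le\frac{t}{I(t)}\,|\nabla f|^{**}(t)$. -/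

import Mathlib

open MeasureTheory Set Filter Topology
open scoped ENNReal NNReal

noncomputable section

namespace MetricIsoperimetry

/-- The decreasing rearrangement `u*(s) = inf {t ≥ 0 : ν {|u| > t} ≤ s}` of a real function `u`
with respect to the measure `ν`. For a finite measure and `s > 0` the set is nonempty as soon as
`u` is measurable. -/
def rearr {α : Type*} [MeasurableSpace α] (ν : Measure α) (u : α → ℝ) (s : ℝ) : ℝ :=
  sInf {t : ℝ | 0 ≤ t ∧ ν {x | t < |u x|} ≤ ENNReal.ofReal s}

/-- `∫₀ᵗ u*(s) ds`, as a value in `[0, ∞]`. -/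
def rearrIntegral {α : Type*} [MeasurableSpace α] (ν : Measure α) (u : α → ℝ) (t : ℝ) : ℝ≥0∞ :=
  ∫⁻ s in Ioo 0 t, ENNReal.ofReal (rearr ν u s)

/-- `u**(t) = (1/t) ∫₀ᵗ u*(s) ds`, as a value in `[0, ∞]`. -/
def rearrAverage {α : Type*} [MeasurableSpace α] (ν : Measure α) (u : α → ℝ) (t : ℝ) : ℝ≥0∞ :=
  rearrIntegral ν u t / ENNReal.ofReal t

section Metric

variable {Ω : Type*} [MetricSpace Ω] [MeasurableSpace Ω]

/-- The Minkowski-type perimeter `liminf_{ε → 0⁺} (μ(A_ε) - μ(A)) / ε`, where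
`A_ε = {x | ∃ y ∈ A, d(x,y) < ε}` is the open `ε`-extension of `A`. -/
def perimeter (μ : Measure Ω) (A : Set Ω) : ℝ≥0∞ :=
  liminf (fun ε : ℝ => (μ (Metric.thickening ε A) - μ A) / ENNReal.ofReal ε) (𝓝[>] 0)

/-- `J` is a function `[0,1] → [0,∞)` with `Per(A) ≥ J(μ(A))` for all Borel sets `A`.
Only the values of `J` on `[0,1]` matter. -/
def IsIsoperimetricMinorant (μ : Measure Ω) (J : ℝ → ℝ) : Prop :=
  (∀ t ∈ Icc (0 : ℝ) 1, 0 ≤ J t) ∧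
    ∀ A : Set Ω, MeasurableSet A → ENNReal.ofReal (J (μ.real A)) ≤ perimeter μ A

/-- `I : [0,1] → [0,∞)` is the isoperimetric profile: the pointwise maximal function with
`Per(A) ≥ I(μ(A))` for all Borel sets `A`. -/
def IsIsoperimetricProfile (μ : Measure Ω) (I : ℝ → ℝ) : Prop :=
  IsIsoperimetricMinorant μ I ∧
    ∀ J : ℝ → ℝ, IsIsoperimetricMinorant μ J → ∀ t ∈ Icc (0 : ℝ) 1, J t ≤ I t

/-- The modulus of the gradient `|∇f|(x) = limsup_{d(x,y) → 0} |f(x) - f(y)| / d(x,y)`;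
it is `0` at isolated points. For Lipschitz `f` the `limsup` is finite. -/
def gradMod (f : Ω → ℝ) (x : Ω) : ℝ :=
  (limsup (fun y => edist (f x) (f y) / edist x y) (𝓝[≠] x)).toReal

/-- Ledoux: `∫₀^∞ I(λ_f(s)) ds ≤ ∫ |∇f| dμ` for all Lipschitz `f`,
where `λ_f(s) = μ {|f| > s}`. -/
def LedouxInequality (μ : Measure Ω) (I : ℝ → ℝ) : Prop :=
  ∀ f : Ω → ℝ, (∃ K : ℝ≥0, LipschitzWith K f) →
    ∫⁻ s in Ioi (0 : ℝ), ENNReal.ofReal (I (μ.real {x | s < |f x|}))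
      ≤ ∫⁻ x, ENNReal.ofReal (gradMod f x) ∂μ

/-- The function `s ↦ ∫_{|f| > f*(s)} |∇f| dμ`. -/
def levelGradIntegral (μ : Measure Ω) (f : Ω → ℝ) (s : ℝ) : ℝ :=
  ∫ x in {x | rearr μ f s < |f x|}, gradMod f x ∂μ

/-- Talenti–Maz'ya: for all Lipschitz `f`, both derivatives below exist at almost every
`s ∈ (0,1)`, and `(-f*)'(s) I(s) ≤ d/ds ∫_{|f| > f*(s)} |∇f| dμ` wherever they exist. -/
def TalentiMazyaInequality (μ : Measure Ω) (I : ℝ → ℝ) : Prop :=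
  ∀ f : Ω → ℝ, (∃ K : ℝ≥0, LipschitzWith K f) →
    (∀ᵐ s ∂(volume.restrict (Ioo (0 : ℝ) 1)),
      DifferentiableAt ℝ (rearr μ f) s ∧ DifferentiableAt ℝ (levelGradIntegral μ f) s) ∧
    ∀ s ∈ Ioo (0 : ℝ) 1,
      DifferentiableAt ℝ (rearr μ f) s → DifferentiableAt ℝ (levelGradIntegral μ f) s →
        deriv (fun r => -rearr μ f r) s * I s ≤ deriv (levelGradIntegral μ f) s

/-- Pólya–Szegő: `∫₀ᵗ ((-f*)' I)*(s) ds ≤ ∫₀ᵗ |∇f|*(s) ds` for all Lipschitz `f`, where the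
outer rearrangement on the left is with respect to Lebesgue measure on `(0,1)`. -/
def PolyaSzegoInequality (μ : Measure Ω) (I : ℝ → ℝ) : Prop :=
  ∀ f : Ω → ℝ, (∃ K : ℝ≥0, LipschitzWith K f) → ∀ t ∈ Ioc (0 : ℝ) 1,
    rearrIntegral (volume.restrict (Ioo (0 : ℝ) 1))
        (fun s => deriv (fun r => -rearr μ f r) s * I s) t
      ≤ rearrIntegral μ (gradMod f) t

/-- Oscillation inequality: `f**(t) - f*(t) ≤ (t / I(t)) |∇f|**(t)` for all Lipschitz `f` and all
`t` with `I(t) ≠ 0`. Since `f*` is decreasing, `f* ≤ f**`, so the subtraction in `[0,∞]` is the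
usual one; in particular the inequality includes `f**(t) < ∞`. -/
def OscillationInequality (μ : Measure Ω) (I : ℝ → ℝ) : Prop :=
  ∀ f : Ω → ℝ, (∃ K : ℝ≥0, LipschitzWith K f) → ∀ t ∈ Ioc (0 : ℝ) 1, I t ≠ 0 →
    rearrAverage μ f t - ENNReal.ofReal (rearr μ f t)
      ≤ ENNReal.ofReal (t / I t) * rearrAverage μ (gradMod f) t

end Metric

end MetricIsoperimetry

end

open MeasureTheory Set Filter Topology
open scoped ENNReal NNReal

namespace MetricIsoperimetry

/-! Everything follows from one coarea inequality localized to levels (`setLIntegral_profile_le`):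
for Borel `B ⊆ ℝ` and `λ(r) = μ{|f| > r}`, `∫_B I(λ(r)) dr ≤ ∫_{|f| ∈ B} |∇f| dμ`. It comes from
Fubini for the difference quotients in the perimeter, Fatou, and the isoperimetric inequality for
superlevel sets.

Each statement is a choice of `B`. Ledoux: `B = (0,∞)`. Talenti–Maz'ya: `B = (f*(t), f*(s))`, where
`λ ∈ [s,t]` and concavity gives `I(λ) ≥ min (I s) (I t)`; divide by `t - s` and let `t ↓ s`.
Oscillation: `B = (f*(t), ∞)`, where `λ ≤ t` and concavity gives `λ ≤ (t / I t) I(λ)`. Pólya–Szegő: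
`B = f*(E)` with `E = {φ > τ}`, `φ = (-f*)' I`; substituting `r = f*(s)` gives `∫_E φ ≤ ∫_F |∇f|`
with `μ F = |E|`, hence `∫ (φ - τ)₊ ≤ ∫ (|∇f| - τ)₊` for all `τ ≥ 0`, which yields the comparison of
rearrangements.

All four being true, their equivalence is immediate. -/

theorem mul_le_mul_of_concaveOn {I : ℝ → ℝ} (hconc : ConcaveOn ℝ (Icc (0 : ℝ) 1) I) (h0 : 0 ≤ I 0)
    {l t : ℝ} (hl : 0 ≤ l) (hlt : l ≤ t) (ht0 : 0 < t) (ht : t ≤ 1) : l * I t ≤ t * I l := by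
  -- `l` is the convex combination of `0` and `t` with weights `1 - l/t` and `l/t`.
  have h := hconc.2 (left_mem_Icc.2 zero_le_one) ⟨ht0.le, ht⟩
    (sub_nonneg.2 ((div_le_one ht0).2 hlt)) (by positivity) (sub_add_cancel 1 (l / t))
  simp only [smul_eq_mul, mul_zero, zero_add, div_mul_cancel₀ _ ht0.ne'] at h
  have h1 : 0 ≤ (1 - l / t) * I 0 := mul_nonneg (sub_nonneg.2 ((div_le_one ht0).2 hlt)) h0
  have h2 : l / t * I t ≤ I l := by linarith
  calc l * I t = t * (l / t * I t) := by field_simp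
    _ ≤ t * I l := by gcongr

/-- An antitone function is injective at points of nonzero derivative. -/
theorem eq_of_antitoneOn_of_deriv_ne_zero {g : ℝ → ℝ} {U : Set ℝ} (hg : AntitoneOn g U)
    (hU : OrdConnected U) {s t : ℝ} (hs : s ∈ U) (ht : t ∈ U) (hd : deriv g s ≠ 0)
    (h : g t = g s) : t = s := by
  have hderiv := (differentiableAt_of_deriv_ne_zero hd).hasDerivAt
  by_contra hne
  apply hd
  rcases lt_or_gt_of_ne hne with hlt | hlt
  -- Equal values at `t < s` make `g` constant on `[t, s]`, so its left derivative at `s` is zero.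
  · refine (uniqueDiffWithinAt_Iio s).eq_deriv _ hderiv.hasDerivWithinAt ?_
    refine (hasDerivWithinAt_const s (Iio s) (g s)).congr_of_eventuallyEq ?_ rfl
    filter_upwards [Ioo_mem_nhdsLT hlt] with y hy
    have hy' : y ∈ U := hU.out ht hs ⟨hy.1.le, hy.2.le⟩
    exact le_antisymm ((hg ht hy' hy.1.le).trans_eq h) (hg hy' hs hy.2.le)
  · refine (uniqueDiffWithinAt_Ioi s).eq_deriv _ hderiv.hasDerivWithinAt ?_
    refine (hasDerivWithinAt_const s (Ioi s) (g s)).congr_of_eventuallyEq ?_ rfl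
    filter_upwards [Ioo_mem_nhdsGT hlt] with y hy
    have hy' : y ∈ U := hU.out hs ht ⟨hy.1.le, hy.2.le⟩
    exact le_antisymm (hg hs hy' hy.1.le) (h.symm.le.trans (hg hy' ht hy.2.le))

/-! ### Decreasing rearrangements and layer-cake formulas -/

section Rearrangement

variable {α : Type*} [MeasurableSpace α] {ν : Measure α} {u : α → ℝ} {r s t : ℝ}

theorem bddBelow_rearr_set (ν : Measure α) (u : α → ℝ) (s : ℝ) :
    BddBelow {t : ℝ | 0 ≤ t ∧ ν {x | t < |u x|} ≤ ENNReal.ofReal s} :=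
  ⟨0, fun _ h => h.1⟩

theorem rearr_nonneg (ν : Measure α) (u : α → ℝ) (s : ℝ) : 0 ≤ rearr ν u s :=
  Real.sInf_nonneg fun _ h => h.1

theorem nonempty_rearr_set [IsFiniteMeasure ν] (hu : AEMeasurable u ν) (hs : 0 < s) :
    {t : ℝ | 0 ≤ t ∧ ν {x | t < |u x|} ≤ ENNReal.ofReal s}.Nonempty := by
  have hlim : Tendsto (fun n : ℕ => ν {x | (n : ℝ) < |u x|}) atTop
      (𝓝 (ν (⋂ n : ℕ, {x | (n : ℝ) < |u x|}))) := by
    refine tendsto_measure_iInter_atTop (fun n => ?_) (fun m n hmn x hx => ?_)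
      ⟨0, measure_ne_top _ _⟩
    · exact nullMeasurableSet_lt aemeasurable_const hu.abs
    · have : (m : ℝ) ≤ n := Nat.cast_le.2 hmn
      simp only [mem_ofPred_eq] at hx ⊢
      linarith
  have hempty : (⋂ n : ℕ, {x | (n : ℝ) < |u x|}) = ∅ := by
    refine eq_empty_of_forall_notMem fun x hx => ?_
    obtain ⟨n, hn⟩ := exists_nat_gt |u x|
    exact lt_asymm hn (mem_iInter.1 hx n)
  rw [hempty, measure_empty] at hlim
  obtain ⟨n, hn⟩ := (hlim.eventually_lt_const (ENNReal.ofReal_pos.2 hs)).exists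
  exact ⟨n, Nat.cast_nonneg n, hn.le⟩

/-- The rearrangement is the generalized inverse of the distribution function. -/
theorem lt_rearr_iff [IsFiniteMeasure ν] (hu : AEMeasurable u ν) (hs : 0 < s) (hr : 0 ≤ r) :
    r < rearr ν u s ↔ ENNReal.ofReal s < ν {x | r < |u x|} := by
  constructor
  · intro h
    by_contra! hle
    exact (csInf_le (bddBelow_rearr_set ν u s) ⟨hr, hle⟩).not_gt h
  · contrapose!
    intro h
    -- Right continuity of the distribution function: the infimum defining `rearr` is attained.
    have hU : {x | r < |u x|} = ⋃ n : ℕ, {x | r + 1 / ((n : ℝ) + 1) < |u x|} := by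
      ext x
      simp only [mem_ofPred_eq, mem_iUnion]
      constructor
      · intro hx
        obtain ⟨n, hn⟩ := exists_nat_one_div_lt (sub_pos.2 hx)
        exact ⟨n, by linarith⟩
      · rintro ⟨n, hn⟩
        have : (0 : ℝ) < 1 / ((n : ℝ) + 1) := by positivity
        linarith
    have hmono : Monotone fun n : ℕ => {x | r + 1 / ((n : ℝ) + 1) < |u x|} := by
      intro m n hmn x hx
      have := Nat.one_div_le_one_div (α := ℝ) hmn
      simp only [mem_ofPred_eq] at hx ⊢
      linarith
    rw [hU, hmono.measure_iUnion]
    refine iSup_le fun n => ?_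
    have hpos : (0 : ℝ) < 1 / ((n : ℝ) + 1) := by positivity
    obtain ⟨t, ht, htr⟩ := exists_lt_of_csInf_lt (nonempty_rearr_set hu hs)
      (show rearr ν u s < r + 1 / ((n : ℝ) + 1) by linarith)
    exact (measure_mono fun x hx => htr.trans hx).trans ht.2

theorem rearr_le_iff [IsFiniteMeasure ν] (hu : AEMeasurable u ν) (hs : 0 < s) (hr : 0 ≤ r) :
    rearr ν u s ≤ r ↔ ν {x | r < |u x|} ≤ ENNReal.ofReal s := by
  rw [← not_lt, lt_rearr_iff hu hs hr, not_lt]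

theorem rearr_antitoneOn [IsFiniteMeasure ν] (hu : AEMeasurable u ν) :
    AntitoneOn (rearr ν u) (Ioi 0) := by
  intro s hs t ht hst
  rw [rearr_le_iff hu ht (rearr_nonneg _ _ _)]
  exact ((rearr_le_iff hu hs (rearr_nonneg _ _ _)).1 le_rfl).trans (ENNReal.ofReal_le_ofReal hst)

theorem aemeasurable_rearr [IsFiniteMeasure ν] (hu : AEMeasurable u ν) (t : ℝ) :
    AEMeasurable (rearr ν u) (volume.restrict (Ioo 0 t)) :=
  aemeasurable_restrict_of_antitoneOn measurableSet_Ioo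
    ((rearr_antitoneOn hu).mono Ioo_subset_Ioi_self)

theorem volume_Ioo_inter_lt_rearr [IsFiniteMeasure ν] (hu : AEMeasurable u ν) (hr : 0 ≤ r)
    (t : ℝ) :
    volume (Ioo 0 t ∩ {s | r < rearr ν u s}) = min (ENNReal.ofReal t) (ν {x | r < |u x|}) := by
  have : Ioo 0 t ∩ {s | r < rearr ν u s} = Ioo 0 (min t (ν.real {x | r < |u x|})) := by
    ext s
    simp only [mem_inter_iff, mem_Ioo, mem_ofPred_eq, lt_min_iff, and_assoc]
    refine and_congr_right fun hs => and_congr_right fun _ => ?_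
    rw [lt_rearr_iff hu hs hr, ENNReal.ofReal_lt_iff_lt_toReal hs.le (measure_ne_top _ _)]
    rfl
  rw [this, Real.volume_Ioo, sub_zero, (ENNReal.ofReal_mono).map_min, ofReal_measureReal]

/-- Layer cake: on `(0,t)` the superlevel set of `u*` at height `r` is an interval starting at `0`,
of length the minimum of `t` and `ν{|u| > r}`. -/
theorem rearrIntegral_eq_lintegral_min [IsFiniteMeasure ν] (hu : AEMeasurable u ν) (t : ℝ) :
    rearrIntegral ν u t =
      ∫⁻ r in Ioi (0 : ℝ), min (ENNReal.ofReal t) (ν {x | r < |u x|}) := by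
  rw [rearrIntegral, lintegral_eq_lintegral_meas_lt _ (ae_of_all _ (rearr_nonneg ν u))
    (aemeasurable_rearr hu t)]
  refine setLIntegral_congr_fun measurableSet_Ioi fun r hr => ?_
  rw [Measure.restrict_apply₀' measurableSet_Ioo.nullMeasurableSet, inter_comm,
    volume_Ioo_inter_lt_rearr hu (le_of_lt hr)]

/-- Bound the minimum by `t` below `τ` and by the distribution function above. Any `τ ≥ 0` is
allowed; `le_rearrIntegral` shows that `τ = u*(t)` is optimal. -/
theorem rearrIntegral_le [IsFiniteMeasure ν] (hu : AEMeasurable u ν) {τ : ℝ} (hτ : 0 ≤ τ)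
    (t : ℝ) :
    rearrIntegral ν u t ≤
      ENNReal.ofReal t * ENNReal.ofReal τ + ∫⁻ r in Ioi τ, ν {x | r < |u x|} := by
  rw [rearrIntegral_eq_lintegral_min hu, ← Ioc_union_Ioi_eq_Ioi hτ,
    lintegral_union measurableSet_Ioi (Ioc_disjoint_Ioi le_rfl)]
  gcongr
  · refine (lintegral_mono fun r => min_le_left _ _).trans ?_
    rw [setLIntegral_const, Real.volume_Ioc, sub_zero]
  · exact min_le_right _ _

theorem le_rearrIntegral [IsFiniteMeasure ν] (hu : AEMeasurable u ν) (ht : 0 < t) :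
    ENNReal.ofReal t * ENNReal.ofReal (rearr ν u t) +
      ∫⁻ r in Ioi (rearr ν u t), ν {x | r < |u x|} ≤ rearrIntegral ν u t := by
  have h0 := rearr_nonneg ν u t
  rw [rearrIntegral_eq_lintegral_min hu, ← Ioc_union_Ioi_eq_Ioi h0,
    lintegral_union measurableSet_Ioi (Ioc_disjoint_Ioi le_rfl),
    Measure.restrict_congr_set Ioo_ae_eq_Ioc.symm]
  refine add_le_add ?_ ?_
  · calc ENNReal.ofReal t * ENNReal.ofReal (rearr ν u t)
        = ∫⁻ _ in Ioo 0 (rearr ν u t), ENNReal.ofReal t := by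
          rw [setLIntegral_const, Real.volume_Ioo, sub_zero]
      _ ≤ _ := setLIntegral_mono' measurableSet_Ioo fun r hr =>
          le_min le_rfl ((lt_rearr_iff hu ht hr.1.le).1 hr.2).le
  · refine setLIntegral_mono' measurableSet_Ioi fun r hr => le_min ?_ le_rfl
    exact (rearr_le_iff hu ht (h0.trans (le_of_lt hr))).1 (le_of_lt hr)

/-- Hardy–Littlewood: the part of `E` where `u > r` has measure at most both `t` and `ν{u > r}`. -/
theorem setLIntegral_le_rearrIntegral [IsFiniteMeasure ν] (hu : AEMeasurable u ν)
    (hu0 : ∀ x, 0 ≤ u x) {E : Set α} (hE : ν E ≤ ENNReal.ofReal t) :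
    ∫⁻ x in E, ENNReal.ofReal (u x) ∂ν ≤ rearrIntegral ν u t := by
  rw [rearrIntegral_eq_lintegral_min hu,
    lintegral_eq_lintegral_meas_lt _ (ae_of_all _ hu0) hu.restrict]
  refine lintegral_mono fun r => le_min ?_ ?_
  · exact ((measure_mono (subset_univ _)).trans_eq (Measure.restrict_apply_univ E)).trans hE
  · simp only [abs_of_nonneg (hu0 _)]
    exact Measure.restrict_apply_le _ _

theorem lintegral_ofReal_sub (hu : AEMeasurable u ν) (τ : ℝ) :
    ∫⁻ x, ENNReal.ofReal (u x - τ) ∂ν = ∫⁻ r in Ioi τ, ν {x | r < u x} := by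
  have h := lintegral_eq_lintegral_meas_lt ν (f := fun x => max (u x - τ) 0)
    (ae_of_all _ fun x => le_max_right _ _) ((hu.sub_const τ).max aemeasurable_const)
  simp only [ENNReal.ofReal_max, ENNReal.ofReal_zero, max_eq_left zero_le] at h
  rw [h, ← lintegral_indicator measurableSet_Ioi, ← lintegral_indicator measurableSet_Ioi,
    -- Translate the levels by `τ`.
    ← lintegral_add_right_eq_self ((Ioi τ).indicator _) τ]
  refine lintegral_congr fun r => ?_
  by_cases hr : 0 < r
  · rw [indicator_of_mem (mem_Ioi.2 hr), indicator_of_mem (by simpa using hr)]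
    congr 1
    ext x
    simp only [mem_ofPred_eq, lt_max_iff, hr.not_gt, or_false, lt_sub_iff_add_lt]
  · rw [indicator_of_notMem (by simpa using hr), indicator_of_notMem (by simpa using hr)]

/-- A function and its decreasing rearrangement are equimeasurable. -/
theorem map_abs_eq_map_rearr [IsProbabilityMeasure ν] (hu : AEMeasurable u ν) :
    ν.map (fun x => |u x|) = (volume.restrict (Ioo 0 1)).map (rearr ν u) := by
  have hm := aemeasurable_rearr hu 1
  have : IsProbabilityMeasure (volume.restrict (Ioo (0 : ℝ) 1)) := ⟨by simp⟩
  have := Measure.isProbabilityMeasure_map hu.abs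
  have := Measure.isProbabilityMeasure_map hm
  refine Measure.ext_of_Iic _ _ fun r => ?_
  rw [← compl_Ioi, prob_compl_eq_one_sub measurableSet_Ioi,
    prob_compl_eq_one_sub measurableSet_Ioi, Measure.map_apply_of_aemeasurable hu.abs
    measurableSet_Ioi, Measure.map_apply_of_aemeasurable hm measurableSet_Ioi]
  congr 1
  rcases lt_or_ge r 0 with hr | hr
  · have h1 : (fun x => |u x|) ⁻¹' Ioi r = univ :=
      eq_univ_of_forall fun x => hr.trans_le (abs_nonneg _)
    have h2 : rearr ν u ⁻¹' Ioi r = univ :=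
      eq_univ_of_forall fun x => hr.trans_le (rearr_nonneg _ _ _)
    rw [h1, h2, measure_univ, measure_univ]
  · rw [Measure.restrict_apply₀' measurableSet_Ioo.nullMeasurableSet, inter_comm]
    refine Eq.trans ?_ (volume_Ioo_inter_lt_rearr hu hr 1).symm
    rw [ENNReal.ofReal_one, min_eq_right prob_le_one]
    rfl

/-- If `ν{|u| > u*(s)} < s`, then `u*` would take the value `u*(s)` at some smaller point too,
contradicting the nonzero derivative. -/
theorem measureReal_rearr_lt_eq [IsFiniteMeasure ν] (hu : AEMeasurable u ν) {s : ℝ} (hs : 0 < s)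
    (hd : deriv (rearr ν u) s ≠ 0) : ν.real {x | rearr ν u s < |u x|} = s := by
  have hR0 := rearr_nonneg ν u s
  refine le_antisymm
    (ENNReal.toReal_le_of_le_ofReal hs.le ((rearr_le_iff hu hs hR0).1 le_rfl)) ?_
  by_contra! hlt
  obtain ⟨y, hy, hys⟩ := exists_between hlt
  have hy0 : 0 < y := measureReal_nonneg.trans_lt hy
  have hle : rearr ν u y ≤ rearr ν u s := by
    rw [rearr_le_iff hu hy0 hR0, ← ofReal_measureReal]
    exact ENNReal.ofReal_le_ofReal hy.le
  exact hys.ne (eq_of_antitoneOn_of_deriv_ne_zero (rearr_antitoneOn hu) ordConnected_Ioi hs hy0 hd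
    (le_antisymm hle (rearr_antitoneOn hu hy0 hs hys.le)))

end Rearrangement

/-! ### Slopes and the coarea inequality on closed sets of levels -/

section Coarea

variable {Ω : Type*} [MetricSpace Ω] {f : Ω → ℝ} {K : ℝ≥0}

/-- The supremum of the difference quotients of `f` at `x` over the punctured `ε`-ball. -/
noncomputable def slopeSup (f : Ω → ℝ) (ε : ℝ) (x : Ω) : ℝ≥0∞ :=
  ⨆ y, ⨆ (_ : y ≠ x ∧ dist y x < ε), edist (f x) (f y) / edist x y

theorem le_slopeSup (f : Ω → ℝ) {ε : ℝ} {x y : Ω} (hne : y ≠ x) (hd : dist y x < ε) :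
    edist (f x) (f y) / edist x y ≤ slopeSup f ε x :=
  le_iSup₂ (f := fun y (_ : y ≠ x ∧ dist y x < ε) => edist (f x) (f y) / edist x y) y ⟨hne, hd⟩

theorem slopeSup_mono (f : Ω → ℝ) {δ ε : ℝ} (h : δ ≤ ε) (x : Ω) :
    slopeSup f δ x ≤ slopeSup f ε x :=
  iSup₂_le fun _ hy => le_slopeSup f hy.1 (hy.2.trans_le h)

theorem slopeSup_le (hf : LipschitzWith K f) (ε : ℝ) (x : Ω) : slopeSup f ε x ≤ K :=
  iSup₂_le fun y _ => ENNReal.div_le_of_le_mul (hf x y)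

theorem slopeSup_ne_top (hf : LipschitzWith K f) (ε : ℝ) (x : Ω) : slopeSup f ε x ≠ ∞ :=
  ne_top_of_le_ne_top ENNReal.coe_ne_top (slopeSup_le hf ε x)

theorem abs_sub_abs_le_slopeSup_mul (hf : LipschitzWith K f) {ε : ℝ} {x y : Ω}
    (hd : dist y x < ε) : |f y| - |f x| ≤ (slopeSup f ε x).toReal * ε := by
  have hε : 0 < ε := dist_nonneg.trans_lt hd
  rcases eq_or_ne y x with rfl | hne
  · rw [sub_self]
    positivity
  have hq : dist (f x) (f y) / dist x y ≤ (slopeSup f ε x).toReal := by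
    have := ENNReal.toReal_mono (slopeSup_ne_top hf ε x) (le_slopeSup f hne hd)
    rwa [ENNReal.toReal_div, ← dist_edist, ← dist_edist] at this
  have hpos : 0 < dist x y := dist_pos.2 hne.symm
  calc |f y| - |f x| ≤ |f y - f x| := abs_sub_abs_le_abs_sub _ _
    _ = dist (f x) (f y) := by rw [dist_comm, Real.dist_eq]
    _ ≤ (slopeSup f ε x).toReal * dist x y := (div_le_iff₀ hpos).1 hq
    _ ≤ (slopeSup f ε x).toReal * ε := by
      rw [dist_comm] at hd
      gcongr

/-- A countable decreasing infimum gives measurability of `gradMod` and allows monotone convergence.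
-/
theorem limsup_eq_iInf_slopeSup (f : Ω → ℝ) (x : Ω) :
    limsup (fun y => edist (f x) (f y) / edist x y) (𝓝[≠] x) =
      ⨅ n : ℕ, slopeSup f (1 / ((n : ℝ) + 1)) x := by
  rw [limsup_eq]
  apply le_antisymm
  · refine le_iInf fun n => sInf_le ?_
    have hpos : (0 : ℝ) < 1 / ((n : ℝ) + 1) := by positivity
    filter_upwards [self_mem_nhdsWithin,
      mem_nhdsWithin_of_mem_nhds (Metric.ball_mem_nhds x hpos)] with y hy hy'
    exact le_slopeSup f hy hy'
  · refine le_sInf fun a ha => ?_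
    obtain ⟨δ, hδ, h⟩ := Metric.mem_nhdsWithin_iff.1 ha
    obtain ⟨n, hn⟩ := exists_nat_one_div_lt hδ
    exact (iInf_le _ n).trans (iSup₂_le fun y hy => h ⟨hy.2.trans hn, hy.1⟩)

theorem ofReal_gradMod (hf : LipschitzWith K f) (x : Ω) :
    ENNReal.ofReal (gradMod f x) = ⨅ n : ℕ, slopeSup f (1 / ((n : ℝ) + 1)) x := by
  rw [gradMod, limsup_eq_iInf_slopeSup, ENNReal.ofReal_toReal]
  exact ne_top_of_le_ne_top (slopeSup_ne_top hf _ x) (iInf_le _ 0)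

theorem gradMod_nonneg (f : Ω → ℝ) (x : Ω) : 0 ≤ gradMod f x := ENNReal.toReal_nonneg

theorem gradMod_le (hf : LipschitzWith K f) (x : Ω) : gradMod f x ≤ K := by
  refine ENNReal.toReal_le_coe_of_le_coe ?_
  rw [limsup_eq_iInf_slopeSup]
  exact (iInf_le _ 0).trans (slopeSup_le hf _ x)

variable [MeasurableSpace Ω] [BorelSpace Ω]

theorem measurable_slopeSup (hf : Continuous f) (ε : ℝ) : Measurable (slopeSup f ε) := by
  refine measurable_of_Ioi fun a => IsOpen.measurableSet ?_
  have : slopeSup f ε ⁻¹' Ioi a =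
      ⋃ y, {x | y ≠ x} ∩ {x | dist y x < ε} ∩ {x | a * edist x y < edist (f x) (f y)} := by
    ext x
    simp only [slopeSup, mem_preimage, mem_Ioi, lt_iSup_iff, mem_iUnion, mem_inter_iff,
      mem_ofPred_eq, exists_prop]
    refine exists_congr fun y => and_congr_right fun hy => ?_
    exact ENNReal.lt_div_iff_mul_lt (Or.inl (edist_pos.2 hy.1.symm).ne')
      (Or.inl (edist_ne_top x y))
  rw [this]
  refine isOpen_iUnion fun y => ?_
  -- Multiplication by `a` is continuous only for finite `a`; for `a = ∞` the set is empty.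
  rcases eq_or_ne a ∞ with rfl | ha
  · convert isOpen_empty
    refine eq_empty_of_forall_notMem fun x hx => ?_
    have h1 : ∞ * edist x y < edist (f x) (f y) := hx.2
    rw [ENNReal.top_mul (edist_pos.2 hx.1.1.symm).ne'] at h1
    exact not_top_lt h1
  · refine (isOpen_ne_fun continuous_const continuous_id).inter
      (isOpen_lt (by fun_prop) continuous_const) |>.inter (isOpen_lt ?_ ?_)
    · exact (ENNReal.continuous_const_mul ha).comp (continuous_id.edist continuous_const)
    · exact hf.edist continuous_const

theorem measurable_gradMod (hf : Continuous f) : Measurable (gradMod f) := by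
  refine Measurable.ennreal_toReal ?_
  simp only [limsup_eq_iInf_slopeSup]
  exact Measurable.iInf fun n => measurable_slopeSup hf _

variable (μ : Measure Ω) [IsProbabilityMeasure μ]

/-- Fubini on the pairs `(x, r)` with `|f x| ≤ r` and `x` within `ε` of `{|f| > r}`. For fixed `x`,
these `r` fill at most an interval of length `ε * slopeSup f ε x` starting at `|f x|`. -/
theorem setLIntegral_thickening_sub_div_le (hf : LipschitzWith K f) (C : Set ℝ) {ε : ℝ}
    (hε : 0 < ε) :
    ∫⁻ r in C, (μ (Metric.thickening ε {x | r < |f x|}) - μ {x | r < |f x|}) / ENNReal.ofReal ε ≤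
      ∫⁻ x, ((fun x => |f x|) ⁻¹' Metric.cthickening (K * ε) C).indicator (slopeSup f ε) x ∂μ := by
  set S : Set (Ω × ℝ) := {p | |f p.1| ≤ p.2 ∧ p.1 ∈ Metric.thickening ε {x | p.2 < |f x|}} with hS
  have hSm : MeasurableSet S := by
    refine (isClosed_le (hf.continuous.comp continuous_fst).abs
      continuous_snd).measurableSet.inter (IsOpen.measurableSet ?_)
    change IsOpen {p : Ω × ℝ | p.1 ∈ Metric.thickening ε {x | p.2 < |f x|}}
    have : {p : Ω × ℝ | p.1 ∈ Metric.thickening ε {x | p.2 < |f x|}} =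
        ⋃ y, {p : Ω × ℝ | p.2 < |f y|} ∩ {p : Ω × ℝ | dist p.1 y < ε} := by
      ext p
      simp [Metric.mem_thickening_iff]
    rw [this]
    exact isOpen_iUnion fun y =>
      (isOpen_lt continuous_snd continuous_const).inter (isOpen_lt (by fun_prop) continuous_const)
  have hε0 : ENNReal.ofReal ε ≠ 0 := (ENNReal.ofReal_pos.2 hε).ne'
  have hslice : ∀ r, μ (Metric.thickening ε {x | r < |f x|}) - μ {x | r < |f x|} =
      μ ((fun x => (x, r)) ⁻¹' S) := by
    intro r
    rw [← measure_sdiff (Metric.self_subset_thickening hε _)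
      (isOpen_lt continuous_const hf.continuous.abs).measurableSet.nullMeasurableSet
      (measure_ne_top _ _)]
    congr 1
    ext x
    simp [hS, and_comm]
  simp only [hslice, div_eq_mul_inv]
  rw [lintegral_mul_const' _ _ (ENNReal.inv_ne_top.2 hε0), ← Measure.prod_apply_symm hSm,
    Measure.prod_apply hSm, ← div_eq_mul_inv]
  refine ENNReal.div_le_of_le_mul ?_
  rw [← lintegral_mul_const' _ _ ENNReal.ofReal_ne_top]
  refine lintegral_mono fun x => ?_
  have hbound : ∀ r ∈ Prod.mk x ⁻¹' S, |f x| ≤ r ∧ ∃ y, dist y x < ε ∧ r < |f y| := by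
    rintro r ⟨h1, h2⟩
    obtain ⟨y, hy, hd⟩ := Metric.mem_thickening_iff.1 h2
    exact ⟨h1, y, by rwa [dist_comm], hy⟩
  by_cases hx : |f x| ∈ Metric.cthickening (K * ε) C
  · rw [indicator_of_mem (by exact hx)]
    have hsub : Prod.mk x ⁻¹' S ⊆ Icc |f x| (|f x| + (slopeSup f ε x).toReal * ε) := by
      intro r hr
      obtain ⟨h1, y, hd, hy⟩ := hbound r hr
      exact ⟨h1, by linarith [abs_sub_abs_le_slopeSup_mul hf hd]⟩
    refine (Measure.restrict_apply_le _ _).trans ((measure_mono hsub).trans_eq ?_)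
    rw [Real.volume_Icc, add_sub_cancel_left, ENNReal.ofReal_mul ENNReal.toReal_nonneg,
      ENNReal.ofReal_toReal (slopeSup_ne_top hf ε x)]
  -- An `r ∈ C` in the slice satisfies `|f x| ≤ r < |f y| ≤ |f x| + K ε`, putting `|f x|` within `K
  -- ε` of `C`.
  · have hempty : Prod.mk x ⁻¹' S ∩ C = ∅ := by
      refine eq_empty_of_forall_notMem fun r hr => hx ?_
      obtain ⟨h1, y, hd, hy⟩ := hbound r hr.1
      refine Metric.mem_cthickening_of_dist_le _ r _ _ hr.2 ?_
      have h2 := hf.dist_le_mul x y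
      have h3 : |f y| - |f x| ≤ |f y - f x| := abs_sub_abs_le_abs_sub _ _
      rw [dist_comm, Real.dist_eq, dist_comm] at h2
      have h4 : (K : ℝ) * dist y x ≤ K * ε := by gcongr
      rw [Real.dist_eq, abs_sub_comm, abs_of_nonneg (sub_nonneg.2 h1)]
      linarith
    rw [Measure.restrict_apply (measurable_prodMk_left hSm), hempty, measure_empty]
    exact zero_le

/-- The coarea inequality for the levels of `|f|` in a closed set. -/
theorem setLIntegral_perimeter_le_of_isClosed (hf : LipschitzWith K f) {C : Set ℝ}
    (hC : IsClosed C) :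
    ∫⁻ r in C, perimeter μ {x | r < |f x|} ≤
      ∫⁻ x in (fun x => |f x|) ⁻¹' C, ENNReal.ofReal (gradMod f x) ∂μ := by
  set ε : ℕ → ℝ := fun n => 1 / ((n : ℝ) + 1) with hεdef
  have hε : ∀ n, 0 < ε n := fun n => by positivity
  have hεanti : Antitone ε := fun m n h => Nat.one_div_le_one_div h
  have hεlim : Tendsto ε atTop (𝓝 0) := tendsto_one_div_add_atTop_nhds_zero_nat
  set F : ℕ → Ω → ℝ≥0∞ := fun n =>
    ((fun x => |f x|) ⁻¹' Metric.cthickening (K * ε n) C).indicator (slopeSup f (ε n)) with hF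
  have hFm : ∀ n, Measurable (F n) := fun n =>
    (measurable_slopeSup hf.continuous _).indicator
      (hf.continuous.abs.measurable Metric.isClosed_cthickening.measurableSet)
  have hFanti : Antitone F := by
    intro m n h x
    refine (indicator_le_indicator_of_subset (preimage_mono ?_) (fun _ => zero_le) x).trans
      (indicator_le_indicator (slopeSup_mono f (hεanti h) x))
    exact Metric.cthickening_mono (by gcongr; exact hεanti h) C
  have hFtop : ∫⁻ x, F 0 x ∂μ ≠ ∞ := by
    refine ne_top_of_le_ne_top (ENNReal.coe_ne_top (r := K)) ?_
    calc ∫⁻ x, F 0 x ∂μ ≤ ∫⁻ _, (K : ℝ≥0∞) ∂μ :=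
          lintegral_mono fun x => (indicator_le_self _ _ x).trans (slopeSup_le hf _ x)
      _ = K := by simp
  -- Closedness of `C` enters here: a level outside `C` leaves its thickenings eventually.
  have hFinf : ∀ x, ⨅ n, F n x ≤
      ((fun x => |f x|) ⁻¹' C).indicator (fun x => ENNReal.ofReal (gradMod f x)) x := by
    intro x
    by_cases hx : |f x| ∈ C
    · rw [indicator_of_mem (by exact hx), ofReal_gradMod hf]
      exact iInf_mono fun n => indicator_le_self _ _ x
    · have hlim : Tendsto (fun n => ENNReal.ofReal (K * ε n)) atTop (𝓝 0) := by
        simpa using ENNReal.tendsto_ofReal (hεlim.const_mul (K : ℝ))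
      have hpos : 0 < Metric.infEDist |f x| C := by
        rw [pos_iff_ne_zero]
        exact fun h => hx (hC.closure_eq ▸ Metric.mem_closure_iff_infEDist_zero.2 h)
      obtain ⟨n, hn⟩ := (hlim.eventually_lt_const hpos).exists
      refine (iInf_le _ n).trans ?_
      rw [hF]
      simp only
      rw [indicator_of_notMem]
      · exact zero_le
      · exact fun h => hn.not_ge h
  have hmeas : ∀ n, Measurable fun r =>
      (μ (Metric.thickening (ε n) {x | r < |f x|}) - μ {x | r < |f x|}) / ENNReal.ofReal (ε n) := by
    intro n
    have h1 : Antitone fun r : ℝ => {x | r < |f x|} := fun r s h x hx =>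
      lt_of_le_of_lt h (show s < |f x| from hx)
    refine Measurable.div_const (Measurable.sub ?_ ?_) _
    · exact Antitone.measurable fun r s h =>
        measure_mono (Metric.thickening_subset_of_subset _ (h1 h))
    · exact Antitone.measurable fun r s h => measure_mono (h1 h)
  have hεlim' : Tendsto ε atTop (𝓝[>] 0) :=
    tendsto_nhdsWithin_iff.2 ⟨hεlim, Eventually.of_forall hε⟩
  calc ∫⁻ r in C, perimeter μ {x | r < |f x|}
      ≤ ∫⁻ r in C, liminf (fun n => (μ (Metric.thickening (ε n) {x | r < |f x|}) -
          μ {x | r < |f x|}) / ENNReal.ofReal (ε n)) atTop := by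
        refine lintegral_mono fun r => ?_
        rw [perimeter]
        exact liminf_le_liminf_of_le hεlim'
    _ ≤ liminf (fun n => ∫⁻ r in C, (μ (Metric.thickening (ε n) {x | r < |f x|}) -
          μ {x | r < |f x|}) / ENNReal.ofReal (ε n)) atTop := lintegral_liminf_le hmeas
    _ ≤ liminf (fun n => ∫⁻ x, F n x ∂μ) atTop :=
        liminf_le_liminf (Eventually.of_forall fun n =>
          setLIntegral_thickening_sub_div_le μ hf C (hε n))
    _ = ⨅ n, ∫⁻ x, F n x ∂μ :=
        (tendsto_atTop_iInf fun m n h => lintegral_mono (hFanti h)).liminf_eq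
    _ = ∫⁻ x, ⨅ n, F n x ∂μ := (lintegral_iInf hFm hFanti hFtop).symm
    _ ≤ _ := by
        rw [← lintegral_indicator (hf.continuous.abs.measurable hC.measurableSet)]
        exact lintegral_mono hFinf

end Coarea

/-! ### From closed to Borel sets of levels -/

section Profile

variable {Ω : Type*} [MetricSpace Ω] [MeasurableSpace Ω] [BorelSpace Ω] {f : Ω → ℝ} {K : ℝ≥0}
  {μ : Measure Ω} [IsProbabilityMeasure μ] {I : ℝ → ℝ}

/-- The coarea inequality combined with the isoperimetric inequality. -/
theorem setLIntegral_profile_le (hI : IsIsoperimetricMinorant μ I)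
    (hf : LipschitzWith K f) {B : Set ℝ} (hB : MeasurableSet B) :
    ∫⁻ r in B, ENNReal.ofReal (I (μ.real {x | r < |f x|})) ≤
      ∫⁻ x in (fun x => |f x|) ⁻¹' B, ENNReal.ofReal (gradMod f x) ∂μ := by
  have hclosed : ∀ C : Set ℝ, IsClosed C →
      ∫⁻ r in C, ENNReal.ofReal (I (μ.real {x | r < |f x|})) ≤
        ∫⁻ x in (fun x => |f x|) ⁻¹' C, ENNReal.ofReal (gradMod f x) ∂μ := fun C hC =>
    (lintegral_mono fun r => hI.2 _
      (isOpen_lt continuous_const hf.continuous.abs).measurableSet).trans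
      (setLIntegral_perimeter_le_of_isClosed μ hf hC)
  -- The left side is a finite measure in `B`, so inner regularity by closed sets applies.
  set m : Measure ℝ := volume.withDensity fun r => ENNReal.ofReal (I (μ.real {x | r < |f x|}))
    with hm
  have hfin : IsFiniteMeasure m := by
    refine ⟨?_⟩
    rw [hm, withDensity_apply _ MeasurableSet.univ]
    refine (hclosed univ isClosed_univ).trans_lt ?_
    calc ∫⁻ x in (fun x => |f x|) ⁻¹' univ, ENNReal.ofReal (gradMod f x) ∂μ
        ≤ ∫⁻ _, ENNReal.ofReal K ∂μ :=
          (setLIntegral_le_lintegral _ _).trans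
            (lintegral_mono fun x => ENNReal.ofReal_le_ofReal (gradMod_le hf x))
      _ < ∞ := by simp
  rw [← withDensity_apply _ hB, ← hm, hB.measure_eq_iSup_isClosed_of_ne_top (measure_ne_top m B)]
  refine iSup₂_le fun C hCB => iSup_le fun hC => ?_
  rw [hm, withDensity_apply _ hC.measurableSet]
  exact (hclosed C hC).trans (lintegral_mono_set (preimage_mono hCB))

end Profile

/-! ### The four inequalities -/

section Inequalities

variable {Ω : Type*} [MetricSpace Ω] [MeasurableSpace Ω] [BorelSpace Ω] {f : Ω → ℝ} {K : ℝ≥0}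
  {μ : Measure Ω} [IsProbabilityMeasure μ] {I : ℝ → ℝ}

theorem ledouxInequality (hI : IsIsoperimetricMinorant μ I) : LedouxInequality μ I := by
  rintro f ⟨K, hf⟩
  exact (setLIntegral_profile_le hI hf measurableSet_Ioi).trans (setLIntegral_le_lintegral _ _)

theorem integrable_gradMod (hf : LipschitzWith K f) : Integrable (gradMod f) μ := by
  refine Integrable.of_bound (measurable_gradMod hf.continuous).aestronglyMeasurable K
    (ae_of_all _ fun x => ?_)
  rw [Real.norm_of_nonneg (gradMod_nonneg f x)]
  exact gradMod_le hf x

theorem levelGradIntegral_monotoneOn (hf : LipschitzWith K f) :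
    MonotoneOn (levelGradIntegral μ f) (Ioi 0) := by
  intro s hs t ht hst
  refine setIntegral_mono_set (integrable_gradMod hf).integrableOn
    (ae_of_all _ (gradMod_nonneg f)) (LE.le.eventuallyLE fun x hx => ?_)
  exact (rearr_antitoneOn hf.continuous.aemeasurable hs ht hst).trans_lt hx

theorem rearr_sub_mul_min_le (hI : IsIsoperimetricMinorant μ I)
    (hconc : ConcaveOn ℝ (Icc (0 : ℝ) 1) I) (hf : LipschitzWith K f) {s t : ℝ} (hs : 0 < s)
    (hst : s ≤ t) (ht : t ≤ 1) :
    (rearr μ f s - rearr μ f t) * min (I s) (I t) ≤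
      levelGradIntegral μ f t - levelGradIntegral μ f s := by
  have hfm : AEMeasurable f μ := hf.continuous.aemeasurable
  have hanti := rearr_antitoneOn hfm hs (hs.trans_le hst) hst
  have hmeas : ∀ r, MeasurableSet {x | r < |f x|} := fun r =>
    (isOpen_lt continuous_const hf.continuous.abs).measurableSet
  have hmin : 0 ≤ min (I s) (I t) :=
    le_min (hI.1 s ⟨hs.le, hst.trans ht⟩) (hI.1 t ⟨hs.le.trans hst, ht⟩)
  have hsub : {x | rearr μ f s < |f x|} ⊆ {x | rearr μ f t < |f x|} :=
    fun x hx => hanti.trans_lt hx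
  have hdiff : levelGradIntegral μ f t - levelGradIntegral μ f s =
      ∫ x in {x | rearr μ f t < |f x|} \ {x | rearr μ f s < |f x|}, gradMod f x ∂μ := by
    rw [setIntegral_sdiff (hmeas _) (integrable_gradMod hf).integrableOn hsub]
    rfl
  have hnonneg : 0 ≤ levelGradIntegral μ f t - levelGradIntegral μ f s :=
    sub_nonneg.2 (levelGradIntegral_monotoneOn hf hs (hs.trans_le hst) hst)
  rw [← ENNReal.ofReal_le_ofReal_iff hnonneg, hdiff,
    ofReal_integral_eq_lintegral_ofReal (integrable_gradMod hf).integrableOn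
      (ae_of_all _ (gradMod_nonneg f)), ENNReal.ofReal_mul (sub_nonneg.2 hanti), mul_comm,
    ← Real.volume_Ioo, ← setLIntegral_const]
  calc ∫⁻ _ in Ioo (rearr μ f t) (rearr μ f s), ENNReal.ofReal (min (I s) (I t))
      ≤ ∫⁻ r in Ioo (rearr μ f t) (rearr μ f s), ENNReal.ofReal (I (μ.real {x | r < |f x|})) := by
        refine setLIntegral_mono' measurableSet_Ioo fun r hr => ENNReal.ofReal_le_ofReal ?_
        have hr0 : 0 ≤ r := (rearr_nonneg _ _ _).trans hr.1.le
        refine hconc.min_le_of_mem_Icc ⟨hs.le, hst.trans ht⟩ ⟨hs.le.trans hst, ht⟩ ⟨?_, ?_⟩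
        · have h := (lt_rearr_iff hfm hs hr0).1 hr.2
          exact ((ENNReal.ofReal_lt_iff_lt_toReal hs.le (measure_ne_top _ _)).1 h).le
        · have h := (rearr_le_iff hfm (hs.trans_le hst) hr0).1 hr.1.le
          exact ENNReal.toReal_le_of_le_ofReal (hs.le.trans hst) h
    _ ≤ ∫⁻ x in (fun x => |f x|) ⁻¹' Ioo (rearr μ f t) (rearr μ f s),
          ENNReal.ofReal (gradMod f x) ∂μ := setLIntegral_profile_le hI hf measurableSet_Ioo
    _ ≤ _ := by
        refine lintegral_mono_set fun x hx => ?_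
        exact ⟨hx.1, fun h => lt_asymm (show rearr μ f s < |f x| from h) hx.2⟩

theorem talentiMazyaInequality (hI : IsIsoperimetricMinorant μ I)
    (hconc : ConcaveOn ℝ (Icc (0 : ℝ) 1) I) (hcont : ContinuousOn I (Icc (0 : ℝ) 1)) :
    TalentiMazyaInequality μ I := by
  rintro f ⟨K, hf⟩
  have hfm : AEMeasurable f μ := hf.continuous.aemeasurable
  refine ⟨?_, fun s hs hR hG => ?_⟩
  · rw [ae_restrict_iff' measurableSet_Ioo]
    filter_upwards [(rearr_antitoneOn hfm).neg.ae_differentiableWithinAt_of_mem,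
      (levelGradIntegral_monotoneOn (μ := μ) hf).ae_differentiableWithinAt_of_mem] with s h1 h2 hs
    have hnhds : Ioi (0 : ℝ) ∈ 𝓝 s := Ioi_mem_nhds hs.1
    refine ⟨?_, (h2 hs.1).differentiableAt hnhds⟩
    simpa using ((h1 hs.1).differentiableAt hnhds).neg
  -- Both derivatives exist, so right-hand difference quotients suffice.
  · have hRs : Tendsto (slope (rearr μ f) s) (𝓝[>] s) _ :=
      (hasDerivAt_iff_tendsto_slope.1 hR.hasDerivAt).mono_left
      (nhdsWithin_mono s fun y (hy : s < y) => hy.ne')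
    have hGs : Tendsto (slope (levelGradIntegral μ f) s) (𝓝[>] s) _ :=
      (hasDerivAt_iff_tendsto_slope.1 hG.hasDerivAt).mono_left
      (nhdsWithin_mono s fun y (hy : s < y) => hy.ne')
    have hIs : Tendsto I (𝓝[>] s) (𝓝 (I s)) :=
      ((hcont.continuousAt (Icc_mem_nhds hs.1 hs.2)).tendsto).mono_left nhdsWithin_le_nhds
    have hlim : Tendsto (fun y => -slope (rearr μ f) s y * min (I s) (I y)) (𝓝[>] s)
        (𝓝 (-deriv (rearr μ f) s * I s)) := by
      simpa using hRs.neg.mul ((tendsto_const_nhds (x := I s)).min hIs)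
    rw [deriv.fun_neg]
    refine le_of_tendsto_of_tendsto hlim hGs ?_
    filter_upwards [Ioo_mem_nhdsGT hs.2] with y hy
    have h := rearr_sub_mul_min_le hI hconc hf hs.1 hy.1.le hy.2.le
    have hpos : 0 < y - s := sub_pos.2 hy.1
    rw [slope_def_field, slope_def_field, le_div_iff₀ hpos]
    calc -((rearr μ f y - rearr μ f s) / (y - s)) * min (I s) (I y) * (y - s)
        = (rearr μ f s - rearr μ f y) * min (I s) (I y) := by field_simp; ring
      _ ≤ _ := h

theorem oscillationInequality (hI : IsIsoperimetricMinorant μ I)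
    (hconc : ConcaveOn ℝ (Icc (0 : ℝ) 1) I) : OscillationInequality μ I := by
  rintro f ⟨K, hf⟩ t ht hIt
  have hfm : AEMeasurable f μ := hf.continuous.aemeasurable
  have hIpos : 0 < I t := lt_of_le_of_ne (hI.1 t ⟨ht.1.le, ht.2⟩) hIt.symm
  have hR0 := rearr_nonneg μ f t
  -- This tail bounds `t (f**(t) - f*(t))`, by `rearrIntegral_le` at `τ = f*(t)`.
  have htail : ∫⁻ r in Ioi (rearr μ f t), μ {x | r < |f x|} ≤
      ENNReal.ofReal (t / I t) * rearrIntegral μ (gradMod f) t := by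
    calc ∫⁻ r in Ioi (rearr μ f t), μ {x | r < |f x|}
        ≤ ∫⁻ r in Ioi (rearr μ f t),
            ENNReal.ofReal (t / I t) * ENNReal.ofReal (I (μ.real {x | r < |f x|})) := by
          refine setLIntegral_mono' measurableSet_Ioi fun r hr => ?_
          rw [← ENNReal.ofReal_mul (by have := ht.1; positivity), ← ofReal_measureReal]
          refine ENNReal.ofReal_le_ofReal ?_
          have hle : μ.real {x | r < |f x|} ≤ t := ENNReal.toReal_le_of_le_ofReal ht.1.le
            ((rearr_le_iff hfm ht.1 (hR0.trans (le_of_lt hr))).1 (le_of_lt hr))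
          have := mul_le_mul_of_concaveOn hconc (hI.1 0 ⟨le_rfl, zero_le_one⟩)
            measureReal_nonneg hle ht.1 ht.2
          rwa [div_mul_eq_mul_div, le_div_iff₀ hIpos]
      _ = ENNReal.ofReal (t / I t) *
            ∫⁻ r in Ioi (rearr μ f t), ENNReal.ofReal (I (μ.real {x | r < |f x|})) :=
          lintegral_const_mul' _ _ ENNReal.ofReal_ne_top
      _ ≤ _ := by
          gcongr
          refine (setLIntegral_profile_le hI hf measurableSet_Ioi).trans ?_
          exact setLIntegral_le_rearrIntegral (measurable_gradMod hf.continuous).aemeasurable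
            (gradMod_nonneg f) ((rearr_le_iff hfm ht.1 hR0).1 le_rfl)
  have ht0 : ENNReal.ofReal t ≠ 0 := (ENNReal.ofReal_pos.2 ht.1).ne'
  rw [tsub_le_iff_right]
  refine ENNReal.div_le_of_le_mul ?_
  rw [add_mul, rearrAverage, mul_assoc, ENNReal.div_mul_cancel ht0 ENNReal.ofReal_ne_top, add_comm,
    mul_comm (ENNReal.ofReal (rearr μ f t))]
  exact (rearrIntegral_le hfm hR0 t).trans (by gcongr)

/-- The measure-preserving correspondence between sets of levels where `f*` is strictly decreasing
and subsets of `Ω` does not increase the integral of `(-f*)' I` with respect to `|∇f|`. -/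
theorem exists_measure_eq_setLIntegral_le (hI : IsIsoperimetricMinorant μ I)
    (hf : LipschitzWith K f) {E : Set ℝ} (hE : MeasurableSet E) (hE01 : E ⊆ Ioo 0 1)
    (hd : ∀ s ∈ E, deriv (rearr μ f) s ≠ 0) :
    ∃ F : Set Ω, μ F = volume E ∧
      ∫⁻ s in E, ENNReal.ofReal (deriv (fun r => -rearr μ f r) s * I s) ≤
        ∫⁻ x in F, ENNReal.ofReal (gradMod f x) ∂μ := by
  have hfm : AEMeasurable f μ := hf.continuous.aemeasurable
  have hanti := rearr_antitoneOn hfm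
  have hinj : InjOn (rearr μ f) E := fun s hs t ht h =>
    eq_of_antitoneOn_of_deriv_ne_zero hanti ordConnected_Ioi (hE01 ht).1 (hE01 hs).1 (hd t ht) h
  have hderiv : ∀ s ∈ E, HasDerivWithinAt (rearr μ f) (deriv (rearr μ f) s) E s := fun s hs =>
    (differentiableAt_of_deriv_ne_zero (hd s hs)).hasDerivAt.hasDerivWithinAt
  have hB : MeasurableSet (rearr μ f '' E) :=
    measurable_image_of_fderivWithin hE (fun s hs => (hderiv s hs).hasFDerivWithinAt) hinj
  refine ⟨(fun x => |f x|) ⁻¹' (rearr μ f '' E), ?_, ?_⟩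
  · rw [← Measure.map_apply_of_aemeasurable hfm.abs hB, map_abs_eq_map_rearr hfm,
      Measure.map_apply_of_aemeasurable (aemeasurable_rearr hfm 1) hB,
      Measure.restrict_apply₀' measurableSet_Ioo.nullMeasurableSet]
    congr 1
    -- No point of `(0,1)` outside `E` shares a value of `f*` with `E`, so pulling back `f*(E)`
    -- recovers `E`.
    refine Subset.antisymm ?_ fun s hs => ⟨mem_image_of_mem _ hs, hE01 hs⟩
    rintro s ⟨⟨t, ht, hts⟩, hs⟩
    rwa [eq_of_antitoneOn_of_deriv_ne_zero hanti ordConnected_Ioi (hE01 ht).1 hs.1 (hd t ht)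
      hts.symm]
  · refine le_trans (le_of_eq ?_) (setLIntegral_profile_le hI hf hB)
    -- Substitute `r = f*(s)`; on `E` the level `f*(s)` has `λ(f*(s)) = s`, turning `I(λ(r))` into
    -- `I s`.
    rw [lintegral_image_eq_lintegral_deriv_mul_of_antitoneOn hE hderiv
      (hanti.mono fun s hs => (hE01 hs).1)]
    refine setLIntegral_congr_fun hE fun s hs => ?_
    rw [measureReal_rearr_lt_eq hfm (hE01 hs).1 (hd s hs), deriv.fun_neg,
      ENNReal.ofReal_mul' (hI.1 s ⟨(hE01 hs).1.le, (hE01 hs).2.le⟩)]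

/-- On `E = {φ > τ}` compare `∫_E φ` with `∫_F |∇f|`, then cancel `τ |E| = τ μ(F)`, which is finite.
-/
theorem lintegral_ofReal_deriv_rearr_mul_sub_le (hI : IsIsoperimetricMinorant μ I)
    (hcont : ContinuousOn I (Icc (0 : ℝ) 1)) (hf : LipschitzWith K f) {τ : ℝ} (hτ : 0 ≤ τ) :
    ∫⁻ s in Ioo (0 : ℝ) 1, ENNReal.ofReal (deriv (fun r => -rearr μ f r) s * I s - τ) ≤
      ∫⁻ x, ENNReal.ofReal (gradMod f x - τ) ∂μ := by
  set φ : ℝ → ℝ := fun s => deriv (fun r => -rearr μ f r) s * I s with hφ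
  -- A continuous extension of `I` to the line, for the measurability of `E`.
  obtain ⟨J, hJ, hJI⟩ : ∃ J : ℝ → ℝ, Continuous J ∧ EqOn I J (Icc 0 1) :=
    ⟨IccExtend zero_le_one ((Icc (0 : ℝ) 1).domRestrict I), hcont.domRestrict.Icc_extend',
      fun s hs => (IccExtend_of_mem zero_le_one ((Icc (0 : ℝ) 1).domRestrict I) hs).symm⟩
  set E : Set ℝ := Ioo 0 1 ∩ {s | τ < φ s} with hEdef
  have hEm : MeasurableSet E := by
    have : E = Ioo 0 1 ∩ {s | τ < deriv (fun r => -rearr μ f r) s * J s} := by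
      ext s
      refine and_congr_right fun hs => ?_
      simp only [mem_ofPred_eq, hφ, hJI (Ioo_subset_Icc_self hs)]
    rw [this]
    exact measurableSet_Ioo.inter
      (measurableSet_lt measurable_const ((measurable_deriv _).mul hJ.measurable))
  have hd : ∀ s ∈ E, deriv (rearr μ f) s ≠ 0 := by
    rintro s ⟨-, hs⟩ h
    have : φ s = 0 := by simp [hφ, deriv.fun_neg, h]
    exact (hτ.trans_lt hs).ne' this
  obtain ⟨F, hF, hle⟩ := exists_measure_eq_setLIntegral_le hI hf hEm inter_subset_left hd
  have hE_eq : ∫⁻ s in Ioo (0 : ℝ) 1, ENNReal.ofReal (φ s - τ) =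
      ∫⁻ s in E, ENNReal.ofReal (φ s - τ) := by
    rw [← lintegral_indicator measurableSet_Ioo, ← lintegral_indicator hEm]
    rw [hEdef, ← indicator_indicator]
    refine congrArg (lintegral volume) (indicator_congr fun s _ => ?_)
    by_cases h : τ < φ s
    · rw [indicator_of_mem (by exact h)]
    · rw [indicator_of_notMem (by exact h), ENNReal.ofReal_of_nonpos (by linarith)]
  have hτE : ENNReal.ofReal τ * volume E ≠ ∞ := by
    rw [← hF]
    exact ENNReal.mul_ne_top ENNReal.ofReal_ne_top (measure_ne_top _ _)
  rw [hE_eq, ← ENNReal.add_le_add_iff_right hτE]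
  calc (∫⁻ s in E, ENNReal.ofReal (φ s - τ)) + ENNReal.ofReal τ * volume E
      = ∫⁻ s in E, ENNReal.ofReal (φ s) := by
        rw [← setLIntegral_const, ← lintegral_add_right _ measurable_const]
        refine setLIntegral_congr_fun hEm fun s hs => ?_
        rw [← ENNReal.ofReal_add (sub_nonneg.2 (le_of_lt hs.2)) hτ, sub_add_cancel]
    _ ≤ ∫⁻ x in F, ENNReal.ofReal (gradMod f x) ∂μ := hle
    _ ≤ ∫⁻ x in F, (ENNReal.ofReal (gradMod f x - τ) + ENNReal.ofReal τ) ∂μ := by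
        refine lintegral_mono fun x => ?_
        simpa using ENNReal.ofReal_add_le (p := gradMod f x - τ) (q := τ)
    _ = (∫⁻ x in F, ENNReal.ofReal (gradMod f x - τ) ∂μ) + ENNReal.ofReal τ * volume E := by
        rw [lintegral_add_right _ measurable_const, setLIntegral_const, hF]
    _ ≤ _ := by
        gcongr
        exact Measure.restrict_le_self

theorem polyaSzegoInequality (hI : IsIsoperimetricMinorant μ I)
    (hcont : ContinuousOn I (Icc (0 : ℝ) 1)) : PolyaSzegoInequality μ I := by
  rintro f ⟨K, hf⟩ t ht
  have hfm : AEMeasurable f μ := hf.continuous.aemeasurable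
  have hgm : AEMeasurable (gradMod f) μ := (measurable_gradMod hf.continuous).aemeasurable
  set φ : ℝ → ℝ := fun s => deriv (fun r => -rearr μ f r) s * I s with hφ
  have hφm : AEMeasurable φ (volume.restrict (Ioo 0 1)) :=
    (measurable_deriv _).aemeasurable.mul
      ((hcont.mono Ioo_subset_Icc_self).aemeasurable measurableSet_Ioo)
  have hφ0 : ∀ s ∈ Ioo (0 : ℝ) 1, 0 ≤ φ s := by
    intro s hs
    refine mul_nonneg ?_ (hI.1 s (Ioo_subset_Icc_self hs))
    rw [← derivWithin_of_isOpen isOpen_Ioi (mem_Ioi.2 hs.1)]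
    exact (rearr_antitoneOn hfm).neg.derivWithin_nonneg
  have hτ := rearr_nonneg μ (gradMod f) t
  -- Take `τ = |∇f|*(t)`: the upper bound for `φ` holds at every `τ ≥ 0`, and for `|∇f|` the same
  -- expression at this `τ` is a lower bound. Only the tails above `τ` remain to be compared.
  refine (rearrIntegral_le hφm hτ t).trans (le_trans ?_ (le_rearrIntegral hgm ht.1))
  refine add_le_add le_rfl ?_
  rw [← lintegral_ofReal_sub hφm.abs, ← lintegral_ofReal_sub hgm.abs]
  simp only [abs_of_nonneg (gradMod_nonneg f _)]
  refine le_trans (le_of_eq ?_) (lintegral_ofReal_deriv_rearr_mul_sub_le hI hcont hf hτ)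
  refine setLIntegral_congr_fun measurableSet_Ioo fun s hs => ?_
  rw [abs_of_nonneg (hφ0 s hs)]

end Inequalities
end MetricIsoperimetry

open MetricIsoperimetry in
theorem theorem1 {Ω : Type*} [MetricSpace Ω] [MeasurableSpace Ω] [BorelSpace Ω]
    (μ : Measure Ω) [IsProbabilityMeasure μ] (I : ℝ → ℝ)
    (hI : IsIsoperimetricProfile μ I)
    (hconc : ConcaveOn ℝ (Icc (0 : ℝ) 1) I)
    (hcont : ContinuousOn I (Icc (0 : ℝ) 1))
    (hmono : MonotoneOn I (Ioo (0 : ℝ) (1 / 2)))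
    (hsymm : ∀ t ∈ Icc (0 : ℝ) 1, I (1 - t) = I t) :
    (LedouxInequality μ I ∧ TalentiMazyaInequality μ I ∧ PolyaSzegoInequality μ I ∧
      OscillationInequality μ I) ∧
    List.TFAE [LedouxInequality μ I, TalentiMazyaInequality μ I, PolyaSzegoInequality μ I,
      OscillationInequality μ I] := by
  have h1 := ledouxInequality hI.1
  have h2 := talentiMazyaInequality hI.1 hconc hcont
  have h3 := polyaSzegoInequality hI.1 hcont
  have h4 := oscillationInequality hI.1 hconc
  refine ⟨⟨h1, h2, h3, h4⟩, ?_⟩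
  simp only [h1, h2, h3, h4, List.tfae_cons_self, List.tfae_singleton]
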